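/- Let $(R,\mathfrak m)$ be a commutative Noetherian local ring. For every $R$-module $N$ fix a projective resolution $P_N$ of $N$, with $P_{N,i}$ its term in homological degree $i$ and $P_{N,i}=0$ for $i<0$. For $R$-modules $M,N$ let $(P_M,P_N)$ be the complex of $R$-modules whose term of cohomological degree $n\in\mathbb Z$ is $\prod_{i\in\mathbb Z}\operatorname{Hom}_R(P_{M,i},P_{N,i-n})$, with differential $f\mapsto \partial f-(-1)^{n}f\partial$. Let $(P_M,P_N)_b$ be its subcomplex of bounded maps, i.e. of those families with only finitely many non-zero components. The Vogel cohomology of the pair is $$\widetilde{\operatorname{Ext}}{}_R^{\,i}(M,N)=H^i\big((P_M,P_N)/(P_M,P_N)_b\big),\qquad i\in\mathbb Z .$$ Then for every $R$-module $M$ the following are equivalent: (i) $\operatorname{pd}_R M$ is finite (the zero module, with $\operatorname{pd}_R 0=-\infty$, counts as having finite projective dimension); (ii) $\widetilde{\operatorname{Ext}}{}_R^{\,i}(M,N)=0$ for all $i\in\mathbb Z$ and all $R$-modules $N$; (iii) $\widetilde{\operatorname{Ext}}{}_R^{\,i}(N,M)=0$ for all $i\in\mathbb Z$ and all $R$-modules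 $N$. Moreover, if $M$ is finitely generated, the same three conditions are equivalent when $N$ in (ii) and (iii) ranges over the finitely generated $R$-modules only. -/

import Mathlib

open CategoryTheory CochainComplex.HomComplex

universe u

noncomputable section

namespace Vogel

variable {R : Type u} [CommRing R]

/-- The bounded homogeneous maps of degree `n` from `F` to `G`: those families
`(F.X p ⟶ G.X (p + n))` for `p : ℤ` with only finitely many non-zero components. -/
def boundedCochain (F G : CochainComplex (ModuleCat.{u} R) ℤ) (n : ℤ) :
    Submodule R (Cochain F G n) where
  carrier := {z | {p : ℤ | z.v p (p + n) rfl ≠ 0}.Finite}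
  zero_mem' := by simp
  add_mem' {a b} ha hb := by
    refine (Set.Finite.union ha hb).subset fun p hp => ?_
    by_contra h
    simp only [Set.mem_union, Set.mem_ofPred_eq, not_or, not_not] at h
    exact hp (by rw [Cochain.add_v, h.1, h.2, add_zero])
  smul_mem' c a ha := by
    refine Set.Finite.subset ha fun p hp h => hp ?_
    rw [Cochain.smul_v, h, smul_zero]

/-- The differential of the Hom complex preserves bounded homogeneous maps. -/
lemma boundedCochain_le_comap (F G : CochainComplex (ModuleCat.{u} R) ℤ) (n m : ℤ) :
    boundedCochain F G n ≤ (boundedCochain F G m).comap (δ_hom R F G n m) := by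
  intro z hz
  change {p : ℤ | (δ n m z).v p (p + m) rfl ≠ 0}.Finite
  by_cases h : n + 1 = m
  · subst h
    have hz' : {p : ℤ | z.v p (p + n) rfl ≠ 0}.Finite := hz
    refine (hz'.union (hz'.preimage ((add_left_injective (1 : ℤ)).injOn))).subset
      fun p hp => ?_
    by_contra hc
    simp only [Set.mem_union, Set.mem_preimage, Set.mem_ofPred_eq, not_or, not_not] at hc
    apply hp
    have h2 : z.v (p + 1) (p + (n + 1)) (by ring) = 0 := by
      have key : ∀ (q : ℤ) (hq : p + 1 + n = q), z.v (p + 1) q hq = 0 := by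
        rintro _ rfl
        exact hc.2
      exact key _ _
    rw [δ_v n (n + 1) rfl z p (p + (n + 1)) rfl (p + n) (p + 1) (by ring) rfl, hc.1, h2]
    simp
  · simp [δ_shape _ _ h]

/-- The quotient of the Hom complex from `F` to `G` (in degree `n`, all families
`(F.X p ⟶ G.X (p + n))`, with differential `f ↦ d ∘ f - (-1) ^ n • f ∘ d`) by its subcomplex of
bounded homogeneous maps, as a cochain complex of `R`-modules. -/
def vogelComplex (F G : CochainComplex (ModuleCat.{u} R) ℤ) :
    CochainComplex (ModuleCat.{u} R) ℤ where
  X n := ModuleCat.of R (Cochain F G n ⧸ boundedCochain F G n)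
  d n m := ModuleCat.ofHom
    ((boundedCochain F G n).mapQ (boundedCochain F G m) (δ_hom R F G n m)
      (boundedCochain_le_comap F G n m))
  shape n m h := by
    ext x
    have : n + 1 ≠ m := h
    simp [δ_shape _ _ this]
  d_comp_d' i j k _ _ := by
    ext x
    simp [δ_δ]

/-- Vogel cohomology in degree `i` of the pair of modules `(M, N)`, computed with the projective
resolutions `P` of `M` and `Q` of `N`; these are regarded as cochain complexes, with the
`j`-th term of a resolution placed in degree `-j`. -/
def vogelExt {M N : ModuleCat.{u} R} (P : ProjectiveResolution M) (Q : ProjectiveResolution N)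
    (i : ℤ) : ModuleCat.{u} R :=
  (vogelComplex P.cochainComplex Q.cochainComplex).homology i

end Vogel

end

/-! ### Syzygies of a resolution as opcycles. -/

section Opcycles

open Limits

variable {C : Type*} [Category* C] [Abelian C]

/-! All conditions say that the identity of `P M` is null-homotopic modulo bounded maps. Bounded
maps absorb composition on both sides, so such a homotopy kills the Vogel cohomology with `M` in
either argument; conversely, the case `N = M`, `i = 0` produces it. In degrees far to the left it
exhibits syzygies as retracts of projectives; conversely, projective syzygies split the resolution
there. Hence it exists exactly when the projective dimension is finite. -/

/-- The short complex `K.opcycles p ⟶ K.X q ⟶ K.opcycles q`. -/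
noncomputable abbrev CochainComplex.opcyclesShortComplex (K : CochainComplex C ℤ) (p q : ℤ) : ShortComplex C :=
  .mk (K.fromOpcycles p q) (K.pOpcycles q)
    (by rw [← cancel_epi (K.pOpcycles p)]; simp)

lemma CochainComplex.opcyclesShortComplex_shortExact (K : CochainComplex C ℤ) {p q : ℤ}
    (hpq : p + 1 = q) (hp : K.ExactAt p) : (K.opcyclesShortComplex p q).ShortExact := by
  have hmono : Mono (K.fromOpcycles p q) := by
    refine Preadditive.mono_of_isZero_kernel' _ (K.homologyIsKernel p q (by simp [hpq])) ?_
    exact hp.isZero_homology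
  have hepi : Epi (K.pOpcycles q) := inferInstance
  refine { exact := ShortComplex.exact_of_g_is_cokernel _ ?_, mono_f := hmono, epi_g := hepi }
  refine CokernelCofork.IsColimit.ofπ' _ _ fun {A} k hk =>
    ⟨K.descOpcycles k p (by simp [← hpq]) ?_, ?_⟩
  · rw [← K.p_fromOpcycles, Category.assoc]
    erw [hk]
    simp
  · simp

variable {M : C} (P : ProjectiveResolution M)

namespace CategoryTheory.ProjectiveResolution

/-- The cokernel of the last differential of a projective resolution of `M` is `M`. -/
noncomputable def opcyclesZeroIso : P.cochainComplex.opcycles 0 ≅ M :=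
  (P.cochainComplex.isoHomologyι 0 1 (by simp)
    ((CochainComplex.isZero_of_isStrictlyLE P.cochainComplex 0 1).eq_of_tgt _ _)).symm ≪≫
    isoOfQuasiIsoAt P.π' 0 ≪≫ HomologicalComplex.singleObjHomologySelfIso _ _ _

lemma opcyclesShortComplex_shortExact (p q : ℤ) (hpq : p + 1 = q) (hp : p < 0) :
    (P.cochainComplex.opcyclesShortComplex p q).ShortExact :=
  P.cochainComplex.opcyclesShortComplex_shortExact hpq
    (P.cochainComplex.exactAt_of_isGE 0 p hp)

/-- Dimension shifting: the opcycles in degree `-n` are the `n`-th syzygy. -/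
lemma hasProjectiveDimensionLT_iff_projective_opcycles (n : ℕ) :
    HasProjectiveDimensionLT M (n + 1) ↔ Projective (P.cochainComplex.opcycles (-n)) := by
  suffices ∀ m k : ℕ, HasProjectiveDimensionLT (P.cochainComplex.opcycles (-m)) (k + 1) ↔
      HasProjectiveDimensionLT M (m + k + 1) by
    rw [projective_iff_hasProjectiveDimensionLT_one]
    exact (this n 0).symm
  intro m
  induction m with
  | zero =>
    intro k
    rw [zero_add]
    exact ⟨fun (_ : HasProjectiveDimensionLT (P.cochainComplex.opcycles 0) (k + 1)) =>
        hasProjectiveDimensionLT_of_iso P.opcyclesZeroIso _,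
      fun _ => hasProjectiveDimensionLT_of_iso P.opcyclesZeroIso.symm _⟩
  | succ m ih =>
    intro k
    have hS := P.opcyclesShortComplex_shortExact (-(m + 1 : ℕ)) (-m) (by lia) (by lia)
    rw [show m + 1 + k + 1 = m + (k + 1) + 1 by lia, ← ih]
    exact (hS.hasProjectiveDimensionLT_X₃_iff k inferInstance).symm

lemma projectiveDimension_ne_top_iff_projective_opcycles :
    projectiveDimension M ≠ ⊤ ↔
      ∃ p₀ ≤ 0, ∀ p ≤ p₀, Projective (P.cochainComplex.opcycles p) := by
  rw [projectiveDimension_ne_top_iff]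
  constructor
  · rintro ⟨n, hn⟩
    refine ⟨-n, by lia, fun p hp => ?_⟩
    obtain ⟨m, rfl⟩ := Int.exists_eq_neg_ofNat (show p ≤ 0 by lia)
    rw [← hasProjectiveDimensionLT_iff_projective_opcycles]
    exact hasProjectiveDimensionLT_of_ge M (n + 1) _ (by lia)
  · rintro ⟨p, hp, h⟩
    obtain ⟨n, rfl⟩ := Int.exists_eq_neg_ofNat hp
    exact ⟨n, (P.hasProjectiveDimensionLT_iff_projective_opcycles n).2 (h _ le_rfl)⟩

end CategoryTheory.ProjectiveResolution

end Opcycles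

/-! ### Contractibility modulo bounded maps. -/

namespace Vogel

variable {R : Type u} [CommRing R] {F G H : CochainComplex (ModuleCat.{u} R) ℤ}

lemma mem_boundedCochain_iff {n : ℤ} (z : Cochain F G n) :
    z ∈ boundedCochain F G n ↔ {p : ℤ | z.v p (p + n) rfl ≠ 0}.Finite := Iff.rfl

lemma comp_mem_boundedCochain_of_left {a b c : ℤ} {z : Cochain F G a}
    (hz : z ∈ boundedCochain F G a) (w : Cochain G H b) (h : a + b = c) :
    z.comp w h ∈ boundedCochain F H c := by
  rw [mem_boundedCochain_iff] at hz ⊢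
  refine hz.subset fun p hp hzero => hp ?_
  rw [Cochain.comp_v z w h p (p + a) (p + c) rfl (by lia), hzero, Limits.zero_comp]

lemma comp_mem_boundedCochain_of_right {a b c : ℤ} (z : Cochain F G a) {w : Cochain G H b}
    (hw : w ∈ boundedCochain G H b) (h : a + b = c) :
    z.comp w h ∈ boundedCochain F H c := by
  rw [mem_boundedCochain_iff] at hw ⊢
  refine (hw.preimage (add_left_injective a).injOn).subset fun p hp hzero => hp ?_
  have key : ∀ (q : ℤ) (hq : p + a + b = q), w.v (p + a) q hq = 0 := by
    rintro _ rfl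
    exact hzero
  rw [Cochain.comp_v z w h p (p + a) (p + c) rfl (by lia), key, Limits.comp_zero]

lemma isZero_homology_vogelComplex_iff (i : ℤ) :
    Limits.IsZero ((vogelComplex F G).homology i) ↔
      ∀ z : Cochain F G i, δ i (i + 1) z ∈ boundedCochain F G (i + 1) →
        ∃ w : Cochain F G (i - 1), z - δ (i - 1) i w ∈ boundedCochain F G i := by
  rw [← HomologicalComplex.exactAt_iff_isZero_homology,
    HomologicalComplex.exactAt_iff' _ (i - 1) i (i + 1) (by simp) (by simp),
    ShortComplex.moduleCat_exact_iff]
  constructor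
  · intro h z hz
    obtain ⟨w, hw⟩ := h (Submodule.Quotient.mk z) ((Submodule.Quotient.mk_eq_zero _).2 hz)
    obtain ⟨w, rfl⟩ := Submodule.Quotient.mk_surjective _ w
    refine ⟨w, ?_⟩
    rw [← Submodule.Quotient.eq]
    exact hw.symm
  · intro h z hz
    obtain ⟨z, rfl⟩ := Submodule.Quotient.mk_surjective _ z
    obtain ⟨w, hw⟩ := h z ((Submodule.Quotient.mk_eq_zero _).1 hz)
    refine ⟨Submodule.Quotient.mk w, ?_⟩
    exact ((Submodule.Quotient.eq _).2 hw).symm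

/-- The identity of `F` is homotopic to zero up to a bounded map. -/
def IsAlmostContractible (F : CochainComplex (ModuleCat.{u} R) ℤ) : Prop :=
  ∃ s : Cochain F F (-1), Cochain.ofHom (𝟙 F) - δ (-1) 0 s ∈ boundedCochain F F 0

lemma IsAlmostContractible.isZero_homology_of_source (hF : IsAlmostContractible F) (i : ℤ) :
    Limits.IsZero ((vogelComplex F G).homology i) := by
  obtain ⟨s, hs⟩ := hF
  refine (isZero_homology_vogelComplex_iff i).2 fun z hz =>
    -- The sign cancels the one the Leibniz rule puts on `δ s` composed with `z`.
    ⟨i.negOnePow • s.comp z (by lia), ?_⟩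
  have h := δ_comp s z (show -1 + i = i - 1 by lia) 0 (i + 1) i (by lia) (by lia) rfl
  have hz' : z - δ (i - 1) i (i.negOnePow • s.comp z (by lia)) =
      (Cochain.ofHom (𝟙 F) - δ (-1) 0 s).comp z (zero_add i) -
        i.negOnePow • s.comp (δ i (i + 1) z) (by lia) := by
    rw [δ_units_smul, h, smul_add, smul_smul, Int.units_mul_self, one_smul, Cochain.sub_comp,
      Cochain.id_comp]
    abel
  rw [hz']
  exact Submodule.sub_mem _ (comp_mem_boundedCochain_of_left hs z _)
    (Submodule.smul_of_tower_mem _ _ (comp_mem_boundedCochain_of_right s hz _))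

lemma IsAlmostContractible.isZero_homology_of_target (hG : IsAlmostContractible G) (i : ℤ) :
    Limits.IsZero ((vogelComplex F G).homology i) := by
  obtain ⟨s, hs⟩ := hG
  refine (isZero_homology_vogelComplex_iff i).2 fun z hz => ⟨z.comp s (by lia), ?_⟩
  have h := δ_comp z s (show i + -1 = i - 1 by lia) (i + 1) 0 i (by lia) rfl (by lia)
  have hz' : z - δ (i - 1) i (z.comp s (by lia)) =
      z.comp (Cochain.ofHom (𝟙 G) - δ (-1) 0 s) (add_zero i) +
        (δ i (i + 1) z).comp s (by lia) := by
    rw [h, Cochain.comp_sub, Cochain.comp_id]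
    simp
    abel
  rw [hz']
  exact Submodule.add_mem _ (comp_mem_boundedCochain_of_right z hs _)
    (comp_mem_boundedCochain_of_left hz s _)

lemma isAlmostContractible_of_isZero_homology
    (hF : Limits.IsZero ((vogelComplex F F).homology 0)) : IsAlmostContractible F :=
  (isZero_homology_vogelComplex_iff 0).1 hF (Cochain.ofHom (𝟙 F)) (by simp)

lemma IsAlmostContractible.projective_opcycles (hF : IsAlmostContractible F)
    (hproj : ∀ p, Projective (F.X p)) : ∃ p₀ ≤ 0, ∀ p ≤ p₀, Projective (F.opcycles p) := by
  obtain ⟨s, hs⟩ := hF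
  obtain ⟨b, hb⟩ := ((mem_boundedCochain_iff _).1 hs).bddBelow
  refine ⟨min 0 (b - 1), min_le_left _ _, fun p hp => ?_⟩
  have h0 : (Cochain.ofHom (𝟙 F) - δ (-1) 0 s).v p p (add_zero p) = 0 := by
    have key : ∀ (q : ℤ) (hq : p + 0 = q), (Cochain.ofHom (𝟙 F) - δ (-1) 0 s).v p q hq = 0 := by
      rintro _ rfl
      by_contra hne
      have : b ≤ p := hb hne
      have := min_le_right 0 (b - 1)
      lia
    exact key _ _
  rw [Cochain.sub_v, Cochain.ofHom_v, HomologicalComplex.id_f,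
    δ_v (-1) 0 rfl s p p (add_zero p) (p - 1) (p + 1) rfl rfl, Int.negOnePow_zero, one_smul,
    sub_eq_zero] at h0
  -- The other term of `δ s` factors through the differential into degree `p`, so `F.pOpcycles p`
  -- kills it.
  have hr : (F.fromOpcycles p (p + 1) ≫ s.v (p + 1) p (by lia)) ≫ F.pOpcycles p = 𝟙 _ := by
    rw [← cancel_epi (F.pOpcycles p)]
    have := congr($h0 ≫ F.pOpcycles p)
    simpa using this.symm
  exact Retract.projective ⟨_, _, hr⟩

lemma isAlmostContractible_of_projective_opcycles {p₀ n₀ : ℤ}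
    (hzero : ∀ p, n₀ < p → Limits.IsZero (F.X p)) (hexact : ∀ p ≤ p₀, F.ExactAt p)
    (hproj : ∀ p ≤ p₀, Projective (F.opcycles p)) : IsAlmostContractible F := by
  have hsplit : ∀ q, ∃ τ : F.opcycles q ⟶ F.X q, ∀ p, q + -1 = p → ∃ ρ : F.X q ⟶ F.opcycles p,
      q ≤ p₀ → F.fromOpcycles p q ≫ ρ = 𝟙 _ ∧ τ ≫ F.pOpcycles q = 𝟙 _ ∧
        ρ ≫ F.fromOpcycles p q + F.pOpcycles q ≫ τ = 𝟙 _ := by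
    intro q
    by_cases hq : q ≤ p₀
    · have := hproj q hq
      let σ := (F.opcyclesShortComplex_shortExact (p := q + -1) (q := q) (by lia)
        (hexact _ (by lia))).splittingOfProjective
      refine ⟨σ.s, ?_⟩
      rintro _ rfl
      exact ⟨σ.r, fun _ => ⟨σ.f_r, σ.s_g, σ.id⟩⟩
    -- Zero is a harmless default: only a bounded range of degrees is affected.
    · exact ⟨0, fun p _ => ⟨0, fun h => absurd h hq⟩⟩
  choose τ ρ hρτ using hsplit
  let s : Cochain F F (-1) := Cochain.mk fun p q hpq => ρ p q hpq ≫ τ q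
  -- Degree `p₀` may fail, since the homotopy there needs the splitting at `p₀ + 1`.
  refine ⟨s, (mem_boundedCochain_iff _).2 ((Set.finite_Icc p₀ n₀).subset fun p hp => ?_)⟩
  by_contra hp'
  apply hp
  have key : (Cochain.ofHom (𝟙 F) - δ (-1) 0 s).v p p (add_zero p) = 0 := by
    by_cases hn : n₀ < p
    · exact (hzero p hn).eq_of_src _ _
    have hp₀ : p + 1 ≤ p₀ := by
      simp only [Set.mem_Icc, not_and_or] at hp'
      omega
    obtain ⟨-, -, h₁⟩ := hρτ p (p - 1) rfl (by omega)
    obtain ⟨-, h₂, -⟩ := hρτ (p - 1) (p - 1 - 1) rfl (by omega)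
    obtain ⟨h₃, -, -⟩ := hρτ (p + 1) p (by omega) hp₀
    rw [Cochain.sub_v, Cochain.ofHom_v, HomologicalComplex.id_f,
      δ_v (-1) 0 rfl s p p (add_zero p) (p - 1) (p + 1) rfl rfl, Int.negOnePow_zero, one_smul,
      Cochain.mk_v, Cochain.mk_v, ← F.p_fromOpcycles, ← F.p_fromOpcycles, Category.assoc,
      Category.assoc, reassoc_of% h₂, reassoc_of% h₃, h₁, sub_self]
  have transport : ∀ (q : ℤ) (hq : p + 0 = q),
      (Cochain.ofHom (𝟙 F) - δ (-1) 0 s).v p q hq = 0 := by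
    intro q hq
    obtain rfl : p = q := by omega
    exact key
  exact transport _ _

lemma isAlmostContractible_cochainComplex_iff {M : ModuleCat.{u} R} (P : ProjectiveResolution M) :
    IsAlmostContractible P.cochainComplex ↔ projectiveDimension M ≠ ⊤ := by
  rw [P.projectiveDimension_ne_top_iff_projective_opcycles]
  refine ⟨fun h => h.projective_opcycles fun _ => inferInstance, ?_⟩
  rintro ⟨p₀, -, h⟩
  -- The bound `-1` avoids degree `0`, where the homology is `M`.
  exact isAlmostContractible_of_projective_opcycles (p₀ := min p₀ (-1)) (n₀ := 0)
    (fun p hp => P.cochainComplex.isZero_of_isStrictlyLE 0 p hp)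
    (fun p hp => P.cochainComplex.exactAt_of_isGE 0 p (by have := hp.trans (min_le_right _ _); lia))
    (fun p hp => h p (hp.trans (min_le_left _ _)))

end Vogel

theorem proposition1p1 {R : Type u} [CommRing R] [IsNoetherianRing R] [IsLocalRing R]
    (P : ∀ N : ModuleCat.{u} R, ProjectiveResolution N) (M : ModuleCat.{u} R) :
    List.TFAE
      [projectiveDimension M ≠ ⊤,
       ∀ (i : ℤ) (N : ModuleCat.{u} R), Limits.IsZero (Vogel.vogelExt (P M) (P N) i),
       ∀ (i : ℤ) (N : ModuleCat.{u} R), Limits.IsZero (Vogel.vogelExt (P N) (P M) i)] ∧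
    (Module.Finite R M → List.TFAE
      [projectiveDimension M ≠ ⊤,
       ∀ (i : ℤ) (N : ModuleCat.{u} R), Module.Finite R N →
         Limits.IsZero (Vogel.vogelExt (P M) (P N) i),
       ∀ (i : ℤ) (N : ModuleCat.{u} R), Module.Finite R N →
         Limits.IsZero (Vogel.vogelExt (P N) (P M) i)]) := by
  have hpd := Vogel.isAlmostContractible_cochainComplex_iff (P M)
  have hself (h : Limits.IsZero (Vogel.vogelExt (P M) (P M) 0)) : projectiveDimension M ≠ ⊤ :=
    hpd.1 (Vogel.isAlmostContractible_of_isZero_homology h)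
  refine ⟨?_, fun hM => ?_⟩
  · tfae_have 1 → 2 := fun h i N => (hpd.2 h).isZero_homology_of_source i
    tfae_have 1 → 3 := fun h i N => (hpd.2 h).isZero_homology_of_target i
    tfae_have 2 → 1 := fun h => hself (h 0 M)
    tfae_have 3 → 1 := fun h => hself (h 0 M)
    tfae_finish
  · tfae_have 1 → 2 := fun h i N _ => (hpd.2 h).isZero_homology_of_source i
    tfae_have 1 → 3 := fun h i N _ => (hpd.2 h).isZero_homology_of_target i
    tfae_have 2 → 1 := fun h => hself (h 0 M hM)
    tfae_have 3 → 1 := fun h => hself (h 0 M hM)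
    tfae_finish
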